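/- Composition of morphisms is written from left to right. **Normal categories.** A *category with subobjects* is a small category $\mathcal C$ with a subcategory $\mathcal P$ (whose morphisms are called inclusions, and for which we write $a\preceq b$ and $j(a,b)$ if there is an inclusion $a\to b$) such that $\mathcal P$ has all objects of $\mathcal C$ and is a strict preorder, every inclusion is a monomorphism of $\mathcal C$, and $h$ is an inclusion whenever $g$ and $hg$ are. A *retraction* is a morphism $q$ with $jq=1$ for some inclusion $j$. A *cone* with vertex $z$ is a family of morphisms $\gamma(c)\colon c\to z$, $c\in v\mathcal C$, with $j(a,b)\gamma(b)=\gamma(a)$ whenever $a\preceq b$, at least one of which is an isomorphism. $\mathcal C$ is *normal* if every inclusion splits (has a right inverse), every morphism $f$ factors as $f=quj$ with $q$ a retraction, $u$ an isomorphism and $j$ an inclusion, and every object $c$ is the vertex of a cone $\mu$ with $\mu(c)=1_c$. Then $f^\circ:=qu$ depends only on $f$, and the set $\widehat{\mathcal C}$ of all cones is a regular semigroup under $(\gamma\cdot\delta)(c)=\gamma(c)\,(\delta(z_\gamma))^\circ$, where $z_\gamma$ is the vertex of $\gamma$. The set $\widehat{\mathcal C}/\mathscr R$ of $\mathscr R$-classes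 $R_\gamma$ is partially ordered by $R_\gamma\sqsubseteq R_\delta\iff\gamma\in\delta\,\widehat{\mathcal C}$. **Supported categories.** Let $\mathfrak D$ be a down-set of $\widehat{\mathcal C}/\mathscr R$. An object $c$ is *connected* by $\mathfrak d\in\mathfrak D$ if $\mathfrak d$ contains an idempotent cone with vertex $c$; this cone is unique and is denoted $\epsilon(c,\mathfrak d)$. The pair $\mathcal C_{\mathfrak D}$ is a *connected category* if every object is connected by some $\mathfrak d\in\mathfrak D$, and a *supported category* if every object is connected by exactly one $\mathfrak d\in\mathfrak D$. A morphism $\mathcal C_{\mathfrak D}\to\mathcal C'_{\mathfrak D'}$ is a pair $(F,G)$ of an inclusion preserving functor $F\colon\mathcal C\to\mathcal C'$ and an order preserving map $G\colon\mathfrak D\to\mathfrak D'$ such that, whenever $c$ is connected by $\mathfrak d$, $F(c)$ is connected by $G(\mathfrak d)$ and $F(\epsilon(c,\mathfrak d)(c'))=\epsilon(F(c),G(\mathfrak d))(F(c'))$ for all $c'\in v\mathcal C$. Let $\mathbf{SC}$ be the category of supported categories. For $\mathcal C_{\mathfrak D}$ in $\mathbf{SC}$ the idempotents $\epsilon(c,\mathfrak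 d)$ of the subsemigroup $\widehat{\mathcal C_{\mathfrak D}}=\{\gamma\in\widehat{\mathcal C}: R_\gamma\in\mathfrak D\}$ form a right regular band $\mathtt E(\mathcal C_{\mathfrak D})$, and $(F,G)\mapsto\big(\epsilon(c,\mathfrak d)\mapsto\epsilon(F(c),G(\mathfrak d))\big)$ makes $\mathtt E$ a functor to the category $\mathbf{RRB}$ of right regular bands. **Right regular bands.** A band (a semigroup of idempotents) is *right regular* if $efe=fe$, and *left regular* if $efe=ef$, for all elements $e,f$; let $\mathbf{RRB}$ and $\mathbf{LRB}$ be the categories of right and of left regular bands and semigroup homomorphisms. For a right regular band $S$ let $\mathbb L(S)$ be the category whose objects are the principal left ideals $Se$, whose morphisms $Se\to Sf$ are the maps $r(e,u,f)\colon x\mapsto xu$ with $u\in eSf$, and whose inclusions are the inclusion maps. For $a\in S$ let $r^a$ be the cone with vertex $Sa$ given by $r^a(Se)=r(e,ea,a)$, and let $\mathfrak R=\{R_{r^e}:e\in S\}$. Then $\mathtt C(S):=\mathbb L(S)_{\mathfrak R}$ is a supported category, and $\mathtt C$ becomes a functor $\mathbf{RRB}\to\mathbf{SC}$ by sending $\phi\colon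 S\to S'$ to $(F_\phi,G_\phi)$ with $F_\phi(Se)=S'(e\phi)$, $F_\phi(r(e,u,f))=r(e\phi,u\phi,f\phi)$ and $G_\phi(R_{r^e})=R_{r^{e\phi}}$. **Theorem.** The functor $\mathtt C\colon\mathbf{RRB}\to\mathbf{SC}$ is left adjoint to the functor $\mathtt E\colon\mathbf{SC}\to\mathbf{RRB}$, by an adjunction whose unit at $B$ is the homomorphism $B\to\mathtt E(\mathtt C(B))$, $b\mapsto r^b$. In particular, $\mathbf{RRB}$ is coreflective in $\mathbf{SC}$, that is, equivalent to a full subcategory of $\mathbf{SC}$ whose inclusion functor has a right adjoint. Dually, $\mathbf{LRB}$ is coreflective in $\mathbf{SC}$ in the same sense. -/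

import Mathlib

open CategoryTheory

universe u

namespace CrossConn

/-! ### Categories with subobjects and normal categories

Composition is written diagrammatically: `f ≫ g` is first `f`, then `g`. -/

/-- A small category together with a subcategory of inclusions, containing all objects, which is a
strict preorder of monomorphisms and which contains `h` whenever it contains `g` and `h ≫ g`. -/
class SubobjectCategory (C : Type u) [SmallCategory C] where
  incl : MorphismProperty C
  incl_id : ∀ a : C, incl (𝟙 a)
  incl_comp : ∀ {a b c : C} (f : a ⟶ b) (g : b ⟶ c), incl f → incl g → incl (f ≫ g)
  incl_unique : ∀ {a b : C} (f g : a ⟶ b), incl f → incl g → f = g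
  incl_antisymm : ∀ {a b : C} (f : a ⟶ b) (g : b ⟶ a), incl f → incl g → a = b
  incl_mono : ∀ {a b : C} (f : a ⟶ b), incl f → Mono f
  incl_of_comp : ∀ {a b c : C} (h : a ⟶ b) (g : b ⟶ c), incl g → incl (h ≫ g) → incl h

/-- The inclusions of a category with subobjects. -/
abbrev IsIncl {C : Type u} [SmallCategory C] [SubobjectCategory C] {a b : C} (f : a ⟶ b) : Prop :=
  SubobjectCategory.incl f

/-- A retraction is a right inverse of an inclusion. -/
def IsRetr {C : Type u} [SmallCategory C] [SubobjectCategory C] {a b : C} (q : a ⟶ b) : Prop :=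
  ∃ j : b ⟶ a, IsIncl j ∧ j ≫ q = 𝟙 b

/-- `f = q ≫ v ≫ j` with `q` a retraction, `v` an isomorphism and `j` an inclusion. -/
structure NormalFactorisation {C : Type u} [SmallCategory C] [SubobjectCategory C] {a b : C}
    (f : a ⟶ b) where
  coim : C
  im : C
  q : a ⟶ coim
  v : coim ⟶ im
  j : im ⟶ b
  q_retr : IsRetr q
  v_iso : IsIso v
  j_incl : IsIncl j
  fac : f = q ≫ v ≫ j

/-- A cone with vertex `z`. -/
@[ext]
structure Cone (C : Type u) [SmallCategory C] [SubobjectCategory C] (z : C) where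
  app : ∀ c : C, c ⟶ z
  w : ∀ {a b : C} (j : a ⟶ b), IsIncl j → j ≫ app b = app a
  exists_iso : ∃ c : C, IsIso (app c)

/-- The elements of `Hat C` are the cones of `C`, each paired with its vertex. -/
structure Hat (C : Type u) [SmallCategory C] [SubobjectCategory C] : Type u where
  vertex : C
  cone : Cone C vertex

/-- A normal category. -/
class NormalCategory (C : Type u) [SmallCategory C] [SubobjectCategory C] : Prop where
  splits : ∀ {a b : C} (j : a ⟶ b), IsIncl j → ∃ q : b ⟶ a, j ≫ q = 𝟙 a
  factors : ∀ {a b : C} (f : a ⟶ b), Nonempty (NormalFactorisation f)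
  exists_cone : ∀ c : C, ∃ γ : Cone C c, γ.app c = 𝟙 c

section

variable {C : Type u} [SmallCategory C] [SubobjectCategory C]

lemma incl_self {a : C} (j : a ⟶ a) (hj : IsIncl j) : j = 𝟙 a :=
  SubobjectCategory.incl_unique _ _ hj (SubobjectCategory.incl_id a)

lemma NormalFactorisation.epi {a b : C} {f : a ⟶ b} (n : NormalFactorisation f) :
    Epi (n.q ≫ n.v) := by
  obtain ⟨c, d, q, v, j, ⟨i, -, hi⟩, hv, hj, hf⟩ := n
  have h1 : IsSplitEpi q := ⟨⟨i, hi⟩⟩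
  change Epi (q ≫ v)
  infer_instance

variable [NormalCategory C]

lemma incl_epi {a b : C} (j : a ⟶ b) (hj : IsIncl j) [Epi j] : a = b := by
  obtain ⟨r, hr⟩ := NormalCategory.splits j hj
  have h : r ≫ j = 𝟙 b := by
    rw [← cancel_epi j, ← Category.assoc, hr, Category.id_comp, Category.comp_id]
  exact SubobjectCategory.incl_antisymm j r hj
    (SubobjectCategory.incl_of_comp r j hj (by rw [h]; exact SubobjectCategory.incl_id b))

lemma NormalFactorisation.unique {a b y : C} {f : a ⟶ b} (n : NormalFactorisation f)
    (p : a ⟶ y) [Epi p] (j : y ⟶ b) (hj : IsIncl j) (h : f = p ≫ j) :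
    (⟨y, p⟩ : Σ x : C, a ⟶ x) = ⟨n.im, n.q ≫ n.v⟩ := by
  obtain ⟨c, d, q, v, i, ⟨s, -, hs⟩, hv, hi, hf⟩ := n
  have hq : IsSplitEpi q := ⟨⟨s, hs⟩⟩
  have hqv : Epi (q ≫ v) := inferInstance
  change _ = (⟨d, q ≫ v⟩ : Σ x : C, a ⟶ x)
  have h2 : v ≫ i = s ≫ p ≫ j := by
    rw [← h, hf, ← Category.assoc s, hs, Category.id_comp]
  have hk : (inv v ≫ s ≫ p) ≫ j = i := by
    rw [Category.assoc, Category.assoc, ← h2, IsIso.inv_hom_id_assoc]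
  have hki : IsIncl (inv v ≫ s ≫ p) :=
    SubobjectCategory.incl_of_comp _ j hj (by rw [hk]; exact hi)
  generalize inv v ≫ s ≫ p = k at *
  have hpk : (q ≫ v) ≫ k = p := by
    have := SubobjectCategory.incl_mono j hj
    rw [← cancel_mono j, Category.assoc, hk, Category.assoc, ← hf, h]
  have hke : Epi k := by
    have : Epi ((q ≫ v) ≫ k) := by rw [hpk]; infer_instance
    exact epi_of_epi (q ≫ v) k
  obtain rfl := incl_epi k hki
  rw [incl_self k hki, Category.comp_id] at hpk
  rw [hpk]

/-- The factorisation of a morphism as an epimorphism followed by an inclusion is unique. -/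
lemma canonical_unique {a b x y : C} (p : a ⟶ x) [Epi p] (j : x ⟶ b) (hj : IsIncl j)
    (q : a ⟶ y) [Epi q] (k : y ⟶ b) (hk : IsIncl k) (h : p ≫ j = q ≫ k) :
    (⟨x, p⟩ : Σ x : C, a ⟶ x) = ⟨y, q⟩ := by
  obtain ⟨n⟩ := NormalCategory.factors (p ≫ j)
  rw [n.unique p j hj rfl, n.unique q k hk h]

/-- A chosen normal factorisation; the image and the epimorphic component that it gives do not
depend on the choice, see `NormalFactorisation.unique`. -/
noncomputable def normalFac {a b : C} (f : a ⟶ b) : NormalFactorisation f :=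
  Classical.choice (NormalCategory.factors f)

/-- The image of a morphism. -/
noncomputable def imObj {a b : C} (f : a ⟶ b) : C := (normalFac f).im

/-- The epimorphic component of a morphism. -/
noncomputable def epiPart {a b : C} (f : a ⟶ b) : a ⟶ imObj f :=
  (normalFac f).q ≫ (normalFac f).v

instance epiPart_epi {a b : C} (f : a ⟶ b) : Epi (epiPart f) := (normalFac f).epi

lemma canonical_exists {a b : C} (f : a ⟶ b) :
    ∃ (x : C) (p : a ⟶ x) (j : x ⟶ b), Epi p ∧ IsIncl j ∧ f = p ≫ j :=
  ⟨(normalFac f).im, (normalFac f).q ≫ (normalFac f).v, (normalFac f).j, (normalFac f).epi,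
    (normalFac f).j_incl, by rw [Category.assoc]; exact (normalFac f).fac⟩

lemma epi_split {a b : C} (p : a ⟶ b) [Epi p] : ∃ s : b ⟶ a, s ≫ p = 𝟙 b := by
  obtain ⟨c, d, q, v, j, ⟨i, -, hi⟩, hv, hj, hf⟩ := Classical.choice (NormalCategory.factors p)
  have : Epi j := by
    have : Epi ((q ≫ v) ≫ j) := by rw [Category.assoc, ← hf]; infer_instance
    exact epi_of_epi (q ≫ v) j
  obtain rfl := incl_epi j hj
  obtain rfl := incl_self j hj
  refine ⟨inv v ≫ i, ?_⟩
  rw [hf, Category.comp_id, Category.assoc, ← Category.assoc i, hi, Category.id_comp,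
    IsIso.inv_hom_id]

/-- The cone `c ↦ γ c ≫ p` for an epimorphism `p` starting at the vertex of `γ`. -/
def Cone.star {z x : C} (γ : Cone C z) (p : z ⟶ x) [Epi p] : Cone C x where
  app c := γ.app c ≫ p
  w j hj := by rw [← Category.assoc, γ.w j hj]
  exists_iso := by
    obtain ⟨d, hd⟩ := γ.exists_iso
    obtain ⟨c, y, q, v, j, ⟨i, hi, hiq⟩, hv, hj, hf⟩ :=
      Classical.choice (NormalCategory.factors (γ.app d ≫ p))
    have : Epi j := by
      have : Epi ((q ≫ v) ≫ j) := by rw [Category.assoc, ← hf]; infer_instance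
      exact epi_of_epi (q ≫ v) j
    obtain rfl := incl_epi j hj
    obtain rfl := incl_self j hj
    refine ⟨c, ?_⟩
    have h : γ.app c ≫ p = v := by
      rw [← γ.w i hi, Category.assoc, hf, ← Category.assoc, hiq, Category.id_comp,
        Category.comp_id]
    rw [h]
    exact hv

/-- The product of cones: `γ · δ = γ * (δ z)°`, where `z` is the vertex of `γ` and `°` denotes the
epimorphic component. -/
noncomputable instance : Mul (Hat C) where
  mul γ δ := ⟨imObj (δ.cone.app γ.vertex), γ.cone.star (epiPart (δ.cone.app γ.vertex))⟩

lemma star_congr {z x y : C} (γ : Cone C z) (p : z ⟶ x) [Epi p] (q : z ⟶ y) [Epi q]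
    (h : (⟨x, p⟩ : Σ x : C, z ⟶ x) = ⟨y, q⟩) : (⟨x, γ.star p⟩ : Hat C) = ⟨y, γ.star q⟩ := by
  obtain ⟨rfl, h2⟩ := Sigma.mk.inj_iff.1 h
  obtain rfl := eq_of_heq h2
  rfl

lemma hat_mul_eq {z x v : C} (γ : Cone C z) (δ : Cone C x) (p : z ⟶ v) [Epi p] (j : v ⟶ x)
    (hj : IsIncl j) (h : δ.app z = p ≫ j) :
    (⟨z, γ⟩ * ⟨x, δ⟩ : Hat C) = ⟨v, γ.star p⟩ :=
  (star_congr γ p (epiPart (δ.app z)) ((normalFac (δ.app z)).unique p j hj h)).symm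

/-- Every product of cones can be computed from some canonical factorisation. -/
lemma hat_mul_exists {z x : C} (γ : Cone C z) (δ : Cone C x) :
    ∃ (v : C) (p : z ⟶ v) (j : v ⟶ x) (_ : Epi p), IsIncl j ∧ δ.app z = p ≫ j ∧
      (⟨z, γ⟩ * ⟨x, δ⟩ : Hat C) = ⟨v, γ.star p⟩ := by
  obtain ⟨v, p, j, hp, hj, h⟩ := canonical_exists (δ.app z)
  exact ⟨v, p, j, hp, hj, h, hat_mul_eq γ δ p j hj h⟩

/-- The cones of a normal category form a semigroup. -/
noncomputable instance : Semigroup (Hat C) where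
  mul_assoc := by
    rintro ⟨z, γ⟩ ⟨x, δ⟩ ⟨y, σ⟩
    obtain ⟨v, p, j, hp, hj, h, e⟩ := hat_mul_exists γ δ
    obtain ⟨v₂, p₂, j₂, hp₂, hj₂, h₂, e₂⟩ := hat_mul_exists δ σ
    obtain ⟨t, q, k, hq, hk, hqk⟩ := canonical_exists (j ≫ p₂)
    have hpq : Epi (p ≫ q) := inferInstance
    rw [e, e₂, hat_mul_eq (γ.star p) σ q (k ≫ j₂) (SubobjectCategory.incl_comp _ _ hk hj₂)
        (by rw [← Category.assoc, ← hqk, Category.assoc, ← h₂, σ.w j hj]),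
      hat_mul_eq γ (δ.star p₂) (p ≫ q) k hk
        (by change δ.app z ≫ p₂ = _; rw [h, Category.assoc, hqk, Category.assoc])]
    refine congrArg (Hat.mk t) (Cone.ext (funext fun c => ?_))
    exact Category.assoc _ _ _

lemma mul_of_app_eq_id {z : C} (γ ε : Cone C z) (h : ε.app z = 𝟙 z) :
    (⟨z, γ⟩ * ⟨z, ε⟩ : Hat C) = ⟨z, γ⟩ := by
  rw [hat_mul_eq γ ε (𝟙 z) (𝟙 z) (SubobjectCategory.incl_id z) (by rw [h, Category.comp_id])]
  exact congrArg (Hat.mk z) (Cone.ext (funext fun c => Category.comp_id _))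

/-- The quasi-order `γ ≤ᵣ δ ↔ γ ∈ δ · Hat C`. -/
instance : Preorder (Hat C) where
  le γ δ := ∃ x : Hat C, γ = δ * x
  le_refl := by
    rintro ⟨z, γ⟩
    obtain ⟨μ, hμ⟩ := NormalCategory.exists_cone z
    exact ⟨⟨z, μ⟩, (mul_of_app_eq_id γ μ hμ).symm⟩
  le_trans := by
    rintro a b c ⟨x, rfl⟩ ⟨y, rfl⟩
    exact ⟨y * x, mul_assoc _ _ _⟩

lemma idem_le_iff {γ δ : Hat C} (hδ : IsIdempotentElem δ) : γ ≤ δ ↔ δ * γ = γ := by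
  constructor
  · rintro ⟨x, rfl⟩
    rw [← mul_assoc, hδ.eq]
  · intro h
    exact ⟨γ, h.symm⟩

lemma idem_app {z : C} (ε : Cone C z) : IsIdempotentElem (⟨z, ε⟩ : Hat C) ↔ ε.app z = 𝟙 z := by
  constructor
  · intro h
    obtain ⟨v, p, j, hp, hj, h1, e⟩ := hat_mul_exists ε ε
    replace h := e.symm.trans h
    obtain ⟨rfl, h2⟩ := Hat.mk.inj h
    obtain rfl := incl_self j hj
    rw [Category.comp_id] at h1
    subst h1
    obtain ⟨d, hd⟩ := ε.exists_iso
    have h3 := congrFun (congrArg Cone.app (eq_of_heq h2)) d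
    change ε.app d ≫ ε.app v = ε.app d at h3
    rw [← cancel_epi (ε.app d), h3, Category.comp_id]
  · exact mul_of_app_eq_id ε ε

end

/-- The poset of `ℛ`-classes of the semigroup of cones. -/
abbrev RPoset (C : Type u) [SmallCategory C] [SubobjectCategory C] [NormalCategory C] : Type u :=
  Antisymmetrization (Hat C) (· ≤ ·)

/-- The `ℛ`-class of a cone. -/
abbrev rClass {C : Type u} [SmallCategory C] [SubobjectCategory C] [NormalCategory C]
    (γ : Hat C) : RPoset C :=
  toAntisymmetrization (· ≤ ·) γ

/-- `ε` is the idempotent cone `ε(c, d)` with vertex `c` in the `ℛ`-class `d`. -/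
def IsIdemCone {C : Type u} [SmallCategory C] [SubobjectCategory C] [NormalCategory C]
    {c : C} (d : RPoset C) (ε : Cone C c) : Prop :=
  IsIdempotentElem (⟨c, ε⟩ : Hat C) ∧ rClass ⟨c, ε⟩ = d

/-- The object `c` is connected by the `ℛ`-class `d`. -/
def ConnectedBy {C : Type u} [SmallCategory C] [SubobjectCategory C] [NormalCategory C]
    (c : C) (d : RPoset C) : Prop :=
  ∃ ε : Cone C c, IsIdemCone d ε

/-- There is at most one idempotent cone with a given vertex in a given `ℛ`-class. -/
lemma IsIdemCone.unique {C : Type u} [SmallCategory C] [SubobjectCategory C] [NormalCategory C]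
    {c : C} {d : RPoset C} {ε ε' : Cone C c} (h : IsIdemCone d ε) (h' : IsIdemCone d ε') :
    ε = ε' := by
  obtain ⟨hi, hd⟩ := h
  obtain ⟨hi', rfl⟩ := h'
  have hle : (⟨c, ε⟩ : Hat C) ≤ ⟨c, ε'⟩ := (Quotient.exact hd).1
  rw [idem_le_iff hi', mul_of_app_eq_id _ _ ((idem_app ε).1 hi)] at hle
  exact (eq_of_heq (Hat.mk.inj hle).2).symm


/-! ### Connected and supported categories -/

/-- A connected category: a normal category with a down-set `D` of the poset of `ℛ`-classes of its
semigroup of cones such that every object is connected by some member of `D`. -/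
structure CC : Type (u + 1) where
  carrier : Type u
  [cat : SmallCategory carrier]
  [sub : SubobjectCategory carrier]
  [normal : NormalCategory carrier]
  D : LowerSet (RPoset carrier)
  connected : ∀ c : carrier, ∃ d ∈ D, ConnectedBy c d

attribute [instance] CC.cat CC.sub CC.normal

/-- A CC-morphism `(F, G)`. The last two fields say that `F c` is connected by `G d` whenever `c` is
connected by `d`, and that then `F (ε(c, d) c') = ε(F c, G d) (F c')` for all objects `c'`. -/
@[ext]
structure CC.Hom (X Y : CC.{u}) where
  F : X.carrier ⥤ Y.carrier
  G : X.D →o Y.D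
  map_incl : ∀ {a b : X.carrier} (j : a ⟶ b), IsIncl j → IsIncl (F.map j)
  map_connected : ∀ (c : X.carrier) (d : X.D), ConnectedBy c d.1 → ConnectedBy (F.obj c) (G d).1
  map_cone : ∀ (c : X.carrier) (d : X.D) (ε : Cone X.carrier c) (ε' : Cone Y.carrier (F.obj c)),
    IsIdemCone d.1 ε → IsIdemCone (G d).1 ε' →
      ∀ c' : X.carrier, F.map (ε.app c') = ε'.app (F.obj c')

/-- The category of connected categories and CC-morphisms. -/
instance : Category CC.{u} where
  Hom := CC.Hom
  id X :=
    { F := 𝟭 X.carrier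
      G := OrderHom.id
      map_incl := fun _ hj => hj
      map_connected := fun _ _ h => h
      map_cone := fun _ _ _ _ h h' _ => by obtain rfl := h.unique h'; rfl }
  comp {X Y Z} m n :=
    { F := m.F ⋙ n.F
      G := n.G.comp m.G
      map_incl := fun j hj => n.map_incl _ (m.map_incl j hj)
      map_connected := fun c d h => n.map_connected _ _ (m.map_connected c d h)
      map_cone := fun c d ε ε'' h h'' c' => by
        obtain ⟨ε', h'⟩ := m.map_connected c d ⟨ε, h⟩
        exact (congrArg n.F.map (m.map_cone c d ε ε' h h' c')).trans
          (n.map_cone _ _ ε' ε'' h' h'' _) }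

/-- The connection semigroup of a connected category. -/
noncomputable def CC.connectionSemigroup (X : CC.{u}) : Subsemigroup (Hat X.carrier) where
  carrier := {γ | rClass γ ∈ X.D}
  mul_mem' := fun {γ δ} hγ _ =>
    X.D.lower (toAntisymmetrization_le_toAntisymmetrization_iff.2 ⟨δ, rfl⟩ :
      rClass (γ * δ) ≤ rClass γ) hγ

/-- A connected category is supported if every object is connected by a unique member of `D`. -/
def CC.IsSupported (X : CC.{u}) : Prop :=
  ∀ c : X.carrier, ∃! d : RPoset X.carrier, d ∈ X.D ∧ ConnectedBy c d

/-- The category of supported categories, a full subcategory of `CC`. -/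
abbrev SC : Type (u + 1) := ObjectProperty.FullSubcategory CC.IsSupported.{u}

/-! ### Right and left regular bands -/

/-- A right regular band. -/
class IsRightRegularBand (S : Type u) [Semigroup S] : Prop where
  idem : ∀ e : S, e * e = e
  reg : ∀ e f : S, e * f * e = f * e

/-- A left regular band. -/
class IsLeftRegularBand (S : Type u) [Semigroup S] : Prop where
  idem : ∀ e : S, e * e = e
  reg : ∀ e f : S, e * f * e = e * f

/-- The category of right regular bands, a full subcategory of the category of semigroups. -/
abbrev RRB : Type (u + 1) :=
  ObjectProperty.FullSubcategory fun S : Semigrp.{u} => IsRightRegularBand S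

/-- The category of left regular bands, a full subcategory of the category of semigroups. -/
abbrev LRB : Type (u + 1) :=
  ObjectProperty.FullSubcategory fun S : Semigrp.{u} => IsLeftRegularBand S

/-! ### The band of idempotent cones of a supported category -/

section

variable {C : Type u} [SmallCategory C] [SubobjectCategory C] [NormalCategory C]

lemma hat_regular (γ : Hat C) : ∃ χ : Hat C, γ * χ * γ = γ := by
  obtain ⟨z, γ⟩ := γ
  obtain ⟨d, hd⟩ := γ.exists_iso
  obtain ⟨μ, hμ⟩ := NormalCategory.exists_cone z
  refine ⟨⟨d, μ.star (inv (γ.app d))⟩, ?_⟩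
  rw [hat_mul_eq γ (μ.star (inv (γ.app d))) (inv (γ.app d)) (𝟙 d) (SubobjectCategory.incl_id d)
      (by change μ.app z ≫ _ = _; rw [hμ, Category.id_comp, Category.comp_id]),
    hat_mul_eq (γ.star (inv (γ.app d))) γ (γ.app d) (𝟙 z) (SubobjectCategory.incl_id z)
      (Category.comp_id _).symm]
  refine congrArg (Hat.mk z) (Cone.ext (funext fun c => ?_))
  change (γ.app c ≫ inv (γ.app d)) ≫ γ.app d = γ.app c
  rw [Category.assoc, IsIso.inv_hom_id, Category.comp_id]

/-- `ℒ`-related cones have the same vertex. -/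
lemma vertex_eq_of_mul {e f : Hat C} (h1 : e * f = e) (h2 : f * e = f) : e.vertex = f.vertex := by
  obtain ⟨z, γ⟩ := e
  obtain ⟨x, δ⟩ := f
  obtain ⟨v, p, j, _, hj, -, e1⟩ := hat_mul_exists γ δ
  obtain ⟨v', p', j', _, hj', -, e2⟩ := hat_mul_exists δ γ
  obtain ⟨rfl, -⟩ := Hat.mk.inj (e1.symm.trans h1)
  obtain ⟨rfl, -⟩ := Hat.mk.inj (e2.symm.trans h2)
  exact SubobjectCategory.incl_antisymm j j' hj hj'

end

section

variable {X : CC.{u}}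

/-- In a supported category there is a unique idempotent cone with a given vertex. -/
lemma idem_eq_of_vertex (hX : X.IsSupported) {e f : Hat X.carrier} (he : IsIdempotentElem e)
    (hf : IsIdempotentElem f) (he' : e ∈ X.connectionSemigroup) (hf' : f ∈ X.connectionSemigroup)
    (h : e.vertex = f.vertex) : e = f := by
  obtain ⟨z, γ⟩ := e
  obtain ⟨x, δ⟩ := f
  obtain rfl : z = x := h
  have hd := (hX z).unique ⟨he', γ, he, rfl⟩ ⟨hf', δ, hf, rfl⟩
  exact congrArg (Hat.mk z) (IsIdemCone.unique ⟨he, hd⟩ ⟨hf, rfl⟩)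

lemma idem_eq_of_mul (hX : X.IsSupported) {e f : Hat X.carrier} (he : IsIdempotentElem e)
    (hf : IsIdempotentElem f) (he' : e ∈ X.connectionSemigroup) (hf' : f ∈ X.connectionSemigroup)
    (h1 : e * f = e) (h2 : f * e = f) : e = f :=
  idem_eq_of_vertex hX he hf he' hf' (vertex_eq_of_mul h1 h2)

lemma mul_mem_connection {e : Hat X.carrier} (he : e ∈ X.connectionSemigroup) (x : Hat X.carrier) :
    e * x ∈ X.connectionSemigroup :=
  X.D.lower (toAntisymmetrization_le_toAntisymmetrization_iff.2 ⟨x, rfl⟩ :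
      rClass (e * x) ≤ rClass e) he

lemma idem_mul (hX : X.IsSupported) {e f : Hat X.carrier} (he : IsIdempotentElem e)
    (hf : IsIdempotentElem f) (he' : e ∈ X.connectionSemigroup) (hf' : f ∈ X.connectionSemigroup) :
    IsIdempotentElem (e * f) := by
  obtain ⟨y, hy⟩ := hat_regular (e * f)
  have hee : ∀ a, e * (e * a) = e * a := fun a => by rw [← mul_assoc, he.eq]
  have hff : ∀ a, f * (f * a) = f * a := fun a => by rw [← mul_assoc, hf.eq]
  obtain ⟨x, hx1, hx2⟩ : ∃ x, e * f * x * (e * f) = e * f ∧ x * (e * f) * x = x := by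
    refine ⟨y * (e * f) * y, ?_, ?_⟩
    · calc e * f * (y * (e * f) * y) * (e * f) = (e * f * y * (e * f)) * y * (e * f) := by
            simp only [mul_assoc]
        _ = e * f := by rw [hy, hy]
    · calc y * (e * f) * y * (e * f) * (y * (e * f) * y)
          = y * ((e * f * y * (e * f)) * y * (e * f)) * y := by simp only [mul_assoc]
        _ = y * (e * f) * y := by rw [hy, hy]
  obtain ⟨g, hg⟩ : ∃ g, g = f * x * e := ⟨_, rfl⟩
  have hgi : g * g = g := by
    calc g * g = f * (x * (e * f) * x) * e := by rw [hg]; simp only [mul_assoc]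
      _ = g := by rw [hx2, hg]
  have hge : g * e = g := by rw [hg, mul_assoc, he.eq]
  have hfg : f * g = g := by rw [hg, ← mul_assoc, ← mul_assoc, hf.eq]
  have haga : e * f * g * (e * f) = e * f := by
    calc e * f * g * (e * f) = e * (f * (f * (x * (e * (e * f))))) := by
          rw [hg]; simp only [mul_assoc]
      _ = e * f * x * (e * f) := by rw [hff, hee]; simp only [mul_assoc]
      _ = e * f := hx1
  have hgm : g ∈ X.connectionSemigroup := by
    rw [hg, mul_assoc]; exact mul_mem_connection hf' _
  have hegi : IsIdempotentElem (e * g) := by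
    change e * g * (e * g) = e * g
    calc e * g * (e * g) = e * (g * e * g) := by simp only [mul_assoc]
      _ = e * g := by rw [hge, hgi]
  have heg : e * g = g := by
    refine idem_eq_of_mul hX hegi hgi (mul_mem_connection he' _) hgm ?_ ?_
    · rw [mul_assoc, hgi]
    · rw [← mul_assoc, hge, hgi]
  have hef : e * f = g * f := by
    calc e * f = e * f * g * (e * f) := haga.symm
      _ = e * (f * g) * (e * f) := by simp only [mul_assoc]
      _ = g * e * f := by rw [hfg, heg, mul_assoc]
      _ = g * f := by rw [hge]
  change e * f * (e * f) = e * f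
  rw [hef]
  calc g * f * (g * f) = g * (f * g) * f := by simp only [mul_assoc]
    _ = g * f := by rw [hfg, hgi]

lemma idem_reg (hX : X.IsSupported) {e f : Hat X.carrier} (he : IsIdempotentElem e)
    (hf : IsIdempotentElem f) (he' : e ∈ X.connectionSemigroup) (hf' : f ∈ X.connectionSemigroup) :
    e * f * e = f * e := by
  have h1 := idem_mul hX he hf he' hf'
  have h2 := idem_mul hX hf he hf' he'
  have h3 := idem_mul hX h1 he (mul_mem_connection he' f) he'
  refine idem_eq_of_mul hX h3 h2 (mul_mem_connection (mul_mem_connection he' f) e)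
    (mul_mem_connection hf' e) ?_ ?_
  · calc e * f * e * (f * e) = e * (f * e * (f * e)) := by simp only [mul_assoc]
      _ = e * f * e := by rw [h2.eq, mul_assoc]
  · calc f * e * (e * f * e) = f * (e * e) * (f * e) := by simp only [mul_assoc]
      _ = f * e := by rw [he.eq, h2.eq]

end

/-- The idempotent cones in the connection semigroup of a supported category. -/
def IdemCones (X : SC.{u}) : Type u := {γ : X.obj.connectionSemigroup // IsIdempotentElem γ}

lemma IdemCones.idem {X : SC.{u}} (γ : IdemCones X) : IsIdempotentElem γ.1.1 :=
  congrArg Subtype.val γ.2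

lemma IdemCones.ext {X : SC.{u}} {γ δ : IdemCones X} (h : γ.1.1.vertex = δ.1.1.vertex) : γ = δ :=
  Subtype.ext (Subtype.ext (idem_eq_of_vertex X.property γ.idem δ.idem γ.1.2 δ.1.2 h))

noncomputable instance (X : SC.{u}) : Semigroup (IdemCones X) where
  mul γ δ := ⟨γ.1 * δ.1, Subtype.ext (idem_mul X.property γ.idem δ.idem γ.1.2 δ.1.2)⟩
  mul_assoc _ _ _ := Subtype.ext (mul_assoc _ _ _)

instance (X : SC.{u}) : IsRightRegularBand (IdemCones X) where
  idem γ := Subtype.ext γ.2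
  reg γ δ := Subtype.ext (Subtype.ext (idem_reg X.property γ.idem δ.idem γ.1.2 δ.1.2))

/-- The CC-morphism underlying an SC-morphism. -/
def scHom {X Y : SC.{u}} (m : X ⟶ Y) : CC.Hom X.obj Y.obj := m.hom

/-- For an SC-morphism `(F, G)`, the map `ε(c, d) ↦ ε(F c, G d)`. -/
noncomputable def idemMap {X Y : SC.{u}} (m : X ⟶ Y) (γ : IdemCones X) : IdemCones Y :=
  have h := (scHom m).map_connected γ.1.1.vertex ⟨rClass γ.1.1, γ.1.2⟩ ⟨γ.1.1.cone, γ.idem, rfl⟩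
  ⟨⟨⟨(scHom m).F.obj γ.1.1.vertex, h.choose⟩, by
      change rClass _ ∈ Y.obj.D
      rw [h.choose_spec.2]
      exact ((scHom m).G ⟨rClass γ.1.1, γ.1.2⟩).2⟩,
    Subtype.ext h.choose_spec.1⟩

lemma idemMap_vertex {X Y : SC.{u}} (m : X ⟶ Y) (γ : IdemCones X) :
    (idemMap m γ).1.1.vertex = (scHom m).F.obj γ.1.1.vertex := rfl

lemma idemMap_isIdemCone {X Y : SC.{u}} (m : X ⟶ Y) (γ : IdemCones X) :
    IsIdemCone ((scHom m).G ⟨rClass γ.1.1, γ.1.2⟩).1 (idemMap m γ).1.1.cone :=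
  ((scHom m).map_connected γ.1.1.vertex ⟨rClass γ.1.1, γ.1.2⟩
    ⟨γ.1.1.cone, γ.idem, rfl⟩).choose_spec

lemma idemMap_app {X Y : SC.{u}} (m : X ⟶ Y) (γ : IdemCones X) (c : X.obj.carrier) :
    (scHom m).F.map (γ.1.1.cone.app c) = (idemMap m γ).1.1.cone.app ((scHom m).F.obj c) :=
  (scHom m).map_cone _ ⟨rClass γ.1.1, γ.1.2⟩ γ.1.1.cone (idemMap m γ).1.1.cone ⟨γ.idem, rfl⟩
    (idemMap_isIdemCone m γ) c

lemma map_mul_vertex {X Y : CC.{u}} (m : CC.Hom X Y) {z x : X.carrier} (γ : Cone X.carrier z)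
    (δ : Cone X.carrier x) (γ' : Cone Y.carrier (m.F.obj z)) (δ' : Cone Y.carrier (m.F.obj x))
    (hδ : ∀ c, m.F.map (δ.app c) = δ'.app (m.F.obj c)) :
    m.F.obj (⟨z, γ⟩ * ⟨x, δ⟩ : Hat X.carrier).vertex =
      (⟨m.F.obj z, γ'⟩ * ⟨m.F.obj x, δ'⟩ : Hat Y.carrier).vertex := by
  obtain ⟨v, p, j, hp, hj, h, e⟩ := hat_mul_exists γ δ
  have hFp : Epi (m.F.map p) := by
    obtain ⟨s, hs⟩ := epi_split p
    have : IsSplitEpi (m.F.map p) := ⟨⟨m.F.map s, by rw [← m.F.map_comp, hs, m.F.map_id]⟩⟩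
    infer_instance
  rw [e, hat_mul_eq γ' δ' (m.F.map p) (m.F.map j) (m.map_incl j hj)
    (by rw [← hδ, h, m.F.map_comp])]

lemma idemMap_mul {X Y : SC.{u}} (m : X ⟶ Y) (γ δ : IdemCones X) :
    idemMap m (γ * δ) = idemMap m γ * idemMap m δ :=
  IdemCones.ext (map_mul_vertex (scHom m) γ.1.1.cone δ.1.1.cone (idemMap m γ).1.1.cone
    (idemMap m δ).1.1.cone (idemMap_app m δ))

/-- The functor from supported categories to right regular bands, taking a supported category to
the band of its idempotent cones. -/
noncomputable def idemFunctor : SC.{u} ⥤ RRB.{u} where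
  obj X := ⟨Semigrp.of (IdemCones X), inferInstanceAs (IsRightRegularBand (IdemCones X))⟩
  map m := ObjectProperty.homMk (Semigrp.ofHom ⟨idemMap m, idemMap_mul m⟩)
  map_id X := by
    refine ObjectProperty.hom_ext _ (Semigrp.ext fun γ => ?_)
    exact IdemCones.ext (X := X) rfl
  map_comp {X Y Z} m n := by
    refine ObjectProperty.hom_ext _ (Semigrp.ext fun γ => ?_)
    exact IdemCones.ext (X := Z) rfl

/-! ### The category of principal left ideals -/

/-- The principal left ideal `S e`. -/
def leftIdeal {S : Type u} [Semigroup S] (e : S) : Set S := {x | ∃ s : S, x = s * e}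

lemma mem_leftIdeal {S : Type u} [Semigroup S] {e x : S} (he : e * e = e) :
    x ∈ leftIdeal e ↔ x * e = x := by
  constructor
  · rintro ⟨s, rfl⟩
    rw [mul_assoc, he]
  · intro h
    exact ⟨x, h.symm⟩

/-- The objects of the category of principal left ideals: the left ideals `S e` with `e` an
idempotent. -/
@[ext]
structure LeftCat (S : Type u) [Semigroup S] : Type u where
  carrier : Set S
  principal : ∃ e : S, e * e = e ∧ carrier = leftIdeal e

/-- The morphisms `r(e, u, f)` with `u ∈ e S f`, that is the maps `S e → S f`, `x ↦ x u`. -/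
@[ext]
structure LeftCat.Hom {S : Type u} [Semigroup S] (I J : LeftCat S) : Type u where
  toFun : I.carrier → J.carrier
  spec : ∃ e f u : S, e * e = e ∧ f * f = f ∧ I.carrier = leftIdeal e ∧ J.carrier = leftIdeal f ∧
    (∃ s : S, u = e * s * f) ∧ ∀ x : I.carrier, (toFun x : S) = x * u

instance {S : Type u} [Semigroup S] : SmallCategory (LeftCat S) where
  Hom := LeftCat.Hom
  id I :=
    { toFun := id
      spec := by
        obtain ⟨e, he, hI⟩ := I.principal
        exact ⟨e, e, e, he, he, hI, hI, ⟨e, by rw [he, he]⟩,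
          fun x => ((mem_leftIdeal he).1 (hI.le x.2)).symm⟩ }
  comp m n :=
    { toFun := n.toFun ∘ m.toFun
      spec := by
        obtain ⟨e, f, u, he, hf, hI, hJ, ⟨s, hs⟩, hu⟩ := m.spec
        obtain ⟨g, h, v, hg, hh, hJ', hK, ⟨t, ht⟩, hv⟩ := n.spec
        refine ⟨e, h, u * v, he, hh, hI, hK, ⟨s * f * g * t, ?_⟩, fun x => ?_⟩
        · rw [hs, ht]; simp only [mul_assoc]
        · rw [Function.comp_apply, hv, hu, mul_assoc] }

section

variable {S : Type u} [Semigroup S]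

/-- The value of a morphism, as an element of the semigroup. -/
def LeftCat.val {I J : LeftCat S} (m : I ⟶ J) (x : I.carrier) : S := (LeftCat.Hom.toFun m x : S)

lemma LeftCat.hom_ext {I J : LeftCat S} {m n : I ⟶ J} (h : ∀ x, val m x = val n x) : m = n :=
  LeftCat.Hom.ext (funext fun x => Subtype.ext (h x))

lemma LeftCat.val_id {I : LeftCat S} (x : I.carrier) : val (𝟙 I) x = x := rfl

lemma LeftCat.val_comp {I J K : LeftCat S} (m : I ⟶ J) (n : J ⟶ K) (x : I.carrier) :
    val (m ≫ n) x = val n (LeftCat.Hom.toFun m x) := rfl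

/-- The inclusions are the inclusion maps between principal left ideals. -/
instance : SubobjectCategory (LeftCat S) where
  incl := fun _ _ m => ∀ x, LeftCat.val m x = x
  incl_id _ _ := rfl
  incl_comp f g hf hg x := (hg _).trans (hf x)
  incl_unique f g hf hg := LeftCat.hom_ext fun x => (hf x).trans (hg x).symm
  incl_antisymm {a b} f g hf hg := LeftCat.ext (Set.Subset.antisymm
    (fun x hx => Set.mem_of_eq_of_mem (hf ⟨x, hx⟩).symm (LeftCat.Hom.toFun f ⟨x, hx⟩).2)
    (fun x hx => Set.mem_of_eq_of_mem (hg ⟨x, hx⟩).symm (LeftCat.Hom.toFun g ⟨x, hx⟩).2))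
  incl_mono f hf := ⟨fun g h e => LeftCat.hom_ext fun x => by
    have h1 := congrArg (fun m => LeftCat.val m x) e
    exact ((hf _).symm.trans h1).trans (hf _)⟩
  incl_of_comp h g hg hhg x := (hg _).symm.trans (hhg x)

namespace LeftCat

/-- The object `S e`. -/
def of (e : S) (he : e * e = e) : LeftCat S := ⟨leftIdeal e, e, he, rfl⟩

/-- An idempotent generator. -/
noncomputable def gen (I : LeftCat S) : S := I.principal.choose

lemma gen_idem (I : LeftCat S) : gen I * gen I = gen I := I.principal.choose_spec.1

lemma carrier_eq (I : LeftCat S) : I.carrier = leftIdeal (gen I) := I.principal.choose_spec.2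

lemma of_gen (I : LeftCat S) : of (gen I) (gen_idem I) = I := LeftCat.ext (carrier_eq I).symm

lemma exists_of (I : LeftCat S) : ∃ (e : S) (he : e * e = e), I = of e he :=
  ⟨gen I, gen_idem I, (of_gen I).symm⟩

lemma gen_mem (I : LeftCat S) : gen I ∈ I.carrier := by
  rw [carrier_eq]; exact ⟨gen I, (gen_idem I).symm⟩

lemma mem_iff {I : LeftCat S} {x : S} : x ∈ I.carrier ↔ x * gen I = x := by
  rw [carrier_eq, mem_leftIdeal (gen_idem I)]

lemma mem_of {e x : S} (he : e * e = e) : x ∈ (of e he).carrier ↔ x * e = x := mem_leftIdeal he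

/-- The morphism `r(e, u, f)`, where `e u = u = u f`. -/
def homOf {e f : S} (he : e * e = e) (hf : f * f = f) (u : S) (h1 : e * u = u) (h2 : u * f = u) :
    of e he ⟶ of f hf :=
  LeftCat.Hom.mk (fun x => ⟨x * u, (mem_of hf).2 (by rw [mul_assoc, h2])⟩)
    ⟨e, f, u, he, hf, rfl, rfl, ⟨u, by rw [h1, h2]⟩, fun _ => rfl⟩

lemma val_homOf {e f : S} (he : e * e = e) (hf : f * f = f) (u : S) (h1 : e * u = u)
    (h2 : u * f = u) (x : (of e he).carrier) : val (homOf he hf u h1 h2) x = x * u := rfl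

lemma hom_form {e f : S} {he : e * e = e} {hf : f * f = f} (m : of e he ⟶ of f hf) :
    ∃ u : S, e * u = u ∧ u * f = u ∧ ∀ x, val m x = x * u := by
  obtain ⟨-, -, u, -, -, -, -, -, hu⟩ := LeftCat.Hom.spec m
  have hee : e ∈ (of e he).carrier := (mem_of he).2 he
  have h0 : val m ⟨e, hee⟩ = e * u := hu _
  refine ⟨e * u, by rw [← mul_assoc, he], ?_, fun x => ?_⟩
  · rw [← h0]; exact (mem_of hf).1 (LeftCat.Hom.toFun m ⟨e, hee⟩).2
  · rw [← mul_assoc, (mem_of he).1 x.2]; exact hu x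

/-- A morphism is determined by its value at a generator. -/
lemma val_eq_gen {I J : LeftCat S} (m : I ⟶ J) (x : I.carrier) :
    val m x = x * val m ⟨gen I, gen_mem I⟩ := by
  obtain ⟨-, -, u, -, -, -, -, -, hu⟩ := LeftCat.Hom.spec m
  have h1 : val m x = x * u := hu x
  have h2 : val m ⟨gen I, gen_mem I⟩ = gen I * u := hu _
  rw [h1, h2, ← mul_assoc, mem_iff.1 x.2]

lemma val_gen_mul {I J : LeftCat S} (m : I ⟶ J) :
    gen I * val m ⟨gen I, gen_mem I⟩ = val m ⟨gen I, gen_mem I⟩ :=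
  (val_eq_gen m ⟨gen I, gen_mem I⟩).symm

lemma val_mul_gen {I J : LeftCat S} (m : I ⟶ J) (x : I.carrier) : val m x * gen J = val m x :=
  mem_iff.1 (LeftCat.Hom.toFun m x).2

lemma val_eqToHom {I J : LeftCat S} (h : I = J) (x : I.carrier) : val (eqToHom h) x = x := by
  subst h; rfl

lemma surj_of_isIso {I J : LeftCat S} (m : I ⟶ J) [IsIso m] (y : J.carrier) :
    ∃ x, val m x = y := by
  refine ⟨LeftCat.Hom.toFun (inv m) y, ?_⟩
  rw [← val_comp, IsIso.inv_hom_id]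
  rfl

lemma epi_of_surj {I J : LeftCat S} (m : I ⟶ J) (h : ∀ y : J.carrier, ∃ x, val m x = y) :
    Epi m := by
  refine ⟨fun g k e => hom_ext fun y => ?_⟩
  obtain ⟨x, hx⟩ := h y
  obtain rfl : LeftCat.Hom.toFun m x = y := Subtype.ext hx
  exact congrArg (fun n => val n x) e

/-- The principal cone `r^a` of an idempotent `a`, with `r^a (S e) = r(e, e a, a)`. -/
def principalCone (a : S) (ha : a * a = a) : Cone (LeftCat S) (of a ha) where
  app I := LeftCat.Hom.mk (fun x => ⟨x * a, x, rfl⟩) (by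
    obtain ⟨e, he, hI⟩ := I.principal
    refine ⟨e, a, e * a, he, ha, hI, rfl, ⟨a, by rw [mul_assoc, ha]⟩, fun x => ?_⟩
    rw [← mul_assoc, (mem_leftIdeal he).1 (hI.le x.2)])
  w {I J} j hj := hom_ext fun x => congrArg (· * a) (hj x)
  exists_iso := by
    refine ⟨of a ha, 𝟙 (of a ha), ?_, ?_⟩ <;>
    exact hom_ext fun x => (mem_of ha).1 x.2

lemma val_principalCone (a : S) (ha : a * a = a) (I : LeftCat S) (x : I.carrier) :
    val ((principalCone a ha).app I) x = x * a := rfl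

lemma hat_ext {γ δ : Hat (LeftCat S)} (hv : γ.vertex.carrier = δ.vertex.carrier)
    (h : ∀ I x, val (γ.cone.app I) x = val (δ.cone.app I) x) : γ = δ := by
  obtain ⟨z, γ⟩ := γ
  obtain ⟨x, δ⟩ := δ
  obtain rfl : z = x := LeftCat.ext hv
  exact congrArg (Hat.mk z) (Cone.ext (funext fun I => hom_ext (h I)))

end LeftCat

end

section

variable {S : Type u} [Semigroup S] [IsRightRegularBand S]

open IsRightRegularBand

/-- The category of principal left ideals of a right regular band is normal. -/
instance : NormalCategory (LeftCat S) where
  splits {I J} j hj := by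
    obtain ⟨e, he, rfl⟩ := I.exists_of
    obtain ⟨f, hf, rfl⟩ := J.exists_of
    refine ⟨LeftCat.homOf hf he (f * e) (by rw [← mul_assoc, hf]) (by rw [mul_assoc, he]), ?_⟩
    refine LeftCat.hom_ext fun x => ?_
    have hx : (x : S) * f = x := by
      have h := (LeftCat.mem_of hf).1 (LeftCat.Hom.toFun j x).2
      rwa [show ((LeftCat.Hom.toFun j x : _) : S) = x from hj x] at h
    rw [LeftCat.val_comp, LeftCat.val_homOf, show ((LeftCat.Hom.toFun j x : _) : S) = x from hj x,
      ← mul_assoc, hx]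
    exact (LeftCat.mem_of he).1 x.2
  factors {I J} m := by
    obtain ⟨e, he, rfl⟩ := I.exists_of
    obtain ⟨f, hf, rfl⟩ := J.exists_of
    obtain ⟨a, h1, h2, hm⟩ := LeftCat.hom_form m
    have ha : a * a = a := idem a
    have hae : a * e * (a * e) = a * e := idem _
    have haea : a * e * a = a := by rw [mul_assoc, h1, ha]
    have hiso : IsIso (LeftCat.homOf hae ha a haea ha) := by
      refine ⟨LeftCat.homOf ha hae (a * e) (by rw [← mul_assoc, ha]) hae, ?_, ?_⟩
      · refine LeftCat.hom_ext fun x => ?_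
        change (x * a) * (a * e) = (x : S)
        rw [mul_assoc, ← mul_assoc a, ha]
        exact (LeftCat.mem_of hae).1 x.2
      · refine LeftCat.hom_ext fun x => ?_
        change (x * (a * e)) * a = (x : S)
        rw [mul_assoc, haea]
        exact (LeftCat.mem_of ha).1 x.2
    exact ⟨{
      coim := LeftCat.of (a * e) hae
      im := LeftCat.of a ha
      q := LeftCat.homOf he hae (a * e) (by rw [← mul_assoc, h1]) hae
      v := LeftCat.homOf hae ha a haea ha
      j := LeftCat.homOf ha hf a ha h2
      q_retr := by
        refine ⟨LeftCat.homOf hae he (a * e) hae (by rw [mul_assoc, he]), fun x => ?_, ?_⟩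
        · exact (LeftCat.mem_of hae).1 x.2
        · refine LeftCat.hom_ext fun x => ?_
          change (x * (a * e)) * (a * e) = (x : S)
          rw [mul_assoc, hae]
          exact (LeftCat.mem_of hae).1 x.2
      v_iso := hiso
      j_incl := fun x => (LeftCat.mem_of ha).1 x.2
      fac := by
        refine LeftCat.hom_ext fun x => ?_
        rw [hm]
        change x * a = x * (a * e) * a * a
        rw [mul_assoc (x : S), haea, mul_assoc, ha] }⟩
  exists_cone I := by
    obtain ⟨e, he, rfl⟩ := I.exists_of
    exact ⟨LeftCat.principalCone e he, LeftCat.hom_ext fun x => (LeftCat.mem_of he).1 x.2⟩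

/-- The principal cone `r^a` as an element of the semigroup of cones. -/
def principal (a : S) : Hat (LeftCat S) := ⟨LeftCat.of a (idem a), LeftCat.principalCone a (idem a)⟩

lemma of_injective {a b : S} (ha : a * a = a) (hb : b * b = b)
    (h : LeftCat.of a ha = LeftCat.of b hb) : a = b := by
  have h1 : a * b = a := (LeftCat.mem_of hb).1 (h ▸ (LeftCat.mem_of ha).2 ha)
  have h2 : b * a = b := (LeftCat.mem_of ha).1 (h.symm ▸ (LeftCat.mem_of hb).2 hb)
  calc a = a * b := h1.symm
    _ = b * a * b := (reg b a).symm
    _ = b := by rw [h2, hb]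

lemma gen_of (a : S) (ha : a * a = a) : LeftCat.gen (LeftCat.of a ha) = a :=
  of_injective (LeftCat.gen_idem _) ha (LeftCat.of_gen _)

lemma principal_injective {a b : S} (h : principal a = principal b) : a = b :=
  of_injective (idem a) (idem b) (congrArg Hat.vertex h)

lemma principal_mul (a b : S) : principal a * principal b = principal (a * b) := by
  have ha : a * a = a := idem a
  have hb : b * b = b := idem b
  have hab : a * b * (a * b) = a * b := idem _
  have h1 : a * (a * b) = a * b := by rw [← mul_assoc, ha]
  have h2 : a * b * b = a * b := by rw [mul_assoc, hb]
  have hepi : Epi (LeftCat.homOf ha hab (a * b) h1 hab) := by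
    refine LeftCat.epi_of_surj _ fun y => ?_
    obtain ⟨s, hs⟩ := y.2
    refine ⟨⟨s * a, s, rfl⟩, ?_⟩
    rw [LeftCat.val_homOf, hs, mul_assoc, h1]
  have h3 := hat_mul_eq (LeftCat.principalCone a ha) (LeftCat.principalCone b hb)
    (LeftCat.homOf ha hab (a * b) h1 hab) (LeftCat.homOf hab hb (a * b) hab h2)
    (fun x => (LeftCat.mem_of hab).1 x.2) (LeftCat.hom_ext fun x => by
      change (x : S) * b = x * (a * b) * (a * b)
      rw [mul_assoc, hab, ← mul_assoc, (LeftCat.mem_of ha).1 x.2])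
  refine h3.trans (LeftCat.hat_ext rfl fun I x => ?_)
  change (x : S) * a * (a * b) = x * (a * b)
  rw [mul_assoc, h1]

lemma principal_idem (a : S) : IsIdempotentElem (principal a) := by
  change principal a * principal a = principal a
  rw [principal_mul, idem]

lemma principal_le_iff {a b : S} : principal a ≤ principal b ↔ b * a = a := by
  rw [idem_le_iff (principal_idem b), principal_mul]
  exact ⟨fun h => principal_injective h, fun h => congrArg principal h⟩

/-- Every cone below a principal cone is principal. -/
lemma eq_principal_of_le {γ : Hat (LeftCat S)} {b : S} (h : γ ≤ principal b) :
    ∃ a : S, γ = principal a := by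
  obtain ⟨⟨y, δ⟩, rfl⟩ := h
  obtain ⟨z, p, j, hp, hj, -, e⟩ := hat_mul_exists (LeftCat.principalCone b (idem b)) δ
  obtain ⟨f, hf, rfl⟩ := z.exists_of
  obtain ⟨a, h1, h2, hm⟩ := LeftCat.hom_form p
  have hval : ∀ I x, LeftCat.val (((LeftCat.principalCone b (idem b)).star p).app I) x = x * a := by
    intro I x
    change LeftCat.val p ⟨x * b, _⟩ = x * a
    rw [hm, mul_assoc, h1]
  refine ⟨a, e.trans (LeftCat.hat_ext ?_ hval)⟩
  ext x
  change x ∈ leftIdeal f ↔ x ∈ leftIdeal a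
  constructor
  · rintro ⟨s, rfl⟩
    obtain ⟨I, hI⟩ := ((LeftCat.principalCone b (idem b)).star p).exists_iso
    obtain ⟨y, hy⟩ := LeftCat.surj_of_isIso
      (((LeftCat.principalCone b (idem b)).star p).app I) ⟨f, f, hf.symm⟩
    rw [hval] at hy
    exact ⟨s * y, by rw [mul_assoc, hy]⟩
  · rintro ⟨s, rfl⟩
    exact ⟨s * a, by rw [mul_assoc, h2]⟩

variable (S) in
/-- The down-set of the `ℛ`-classes of the principal cones. -/
def principalClasses : LowerSet (RPoset (LeftCat S)) where
  carrier := {d | ∃ e : S, d = rClass (principal e)}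
  lower' := by
    rintro _ d hd ⟨b, rfl⟩
    induction d using Antisymmetrization.ind with
    | _ γ =>
      obtain ⟨a, rfl⟩ := eq_principal_of_le (toAntisymmetrization_le_toAntisymmetrization_iff.1 hd)
      exact ⟨a, rfl⟩

lemma idemCone_eq {c : LeftCat S} {d : RPoset (LeftCat S)} {ε : Cone (LeftCat S) c}
    (h : IsIdemCone d ε) (hd : d ∈ principalClasses S) :
    (⟨c, ε⟩ : Hat (LeftCat S)) = principal (LeftCat.gen c) := by
  obtain ⟨b, rfl⟩ := hd
  obtain ⟨a, ha⟩ := eq_principal_of_le (Quotient.exact h.2).1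
  have h1 : c = LeftCat.of a (idem a) := congrArg Hat.vertex ha
  rw [ha, h1, gen_of]

lemma idemCone_val {c : LeftCat S} {d : RPoset (LeftCat S)} {ε : Cone (LeftCat S) c}
    (h : IsIdemCone d ε) (hd : d ∈ principalClasses S) (I : LeftCat S) (x : I.carrier) :
    LeftCat.val (ε.app I) x = x * LeftCat.gen c := by
  have h1 := idemCone_eq h hd
  have : ∀ γ : Hat (LeftCat S), γ = principal (LeftCat.gen c) →
      LeftCat.val (γ.cone.app I) x = x * LeftCat.gen c := by
    rintro _ rfl; rfl
  exact this _ h1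

lemma connectedBy_eq {c : LeftCat S} {d : RPoset (LeftCat S)} (h : ConnectedBy c d)
    (hd : d ∈ principalClasses S) : d = rClass (principal (LeftCat.gen c)) := by
  obtain ⟨ε, hε⟩ := h
  rw [← idemCone_eq hε hd]
  exact hε.2.symm

variable (S) in
/-- The category of principal left ideals of a right regular band, connected by the `ℛ`-classes of
the principal cones, as a supported category. -/
def leftObj : SC.{u} where
  obj :=
    { carrier := LeftCat S
      D := principalClasses S
      connected := fun c => by
        obtain ⟨e, he, rfl⟩ := c.exists_of
        exact ⟨_, ⟨e, rfl⟩, LeftCat.principalCone e he, principal_idem e, rfl⟩ }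
  property c := by
    obtain ⟨e, he, rfl⟩ := LeftCat.exists_of c
    refine ⟨rClass (principal e),
      ⟨⟨e, rfl⟩, LeftCat.principalCone e he, principal_idem e, rfl⟩, ?_⟩
    rintro d ⟨hd, hc⟩
    rw [connectedBy_eq hc hd, gen_of]

end

section

variable {S T : Type u} [Semigroup S] [Semigroup T] [IsRightRegularBand T]

open IsRightRegularBand

lemma map_gen (φ : S →ₙ* T) (I : LeftCat S) :
    φ (LeftCat.gen I) * φ (LeftCat.gen I) = φ (LeftCat.gen I) := idem _

/-- The functor `S e ↦ T (φ e)`, `r(e, u, f) ↦ r(φ e, φ u, φ f)`. -/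
noncomputable def leftMapF (φ : S →ₙ* T) : LeftCat S ⥤ LeftCat T where
  obj I := LeftCat.of (φ (LeftCat.gen I)) (map_gen φ I)
  map {I J} m := LeftCat.homOf (map_gen φ I) (map_gen φ J)
    (φ (LeftCat.val m ⟨LeftCat.gen I, LeftCat.gen_mem I⟩))
    (by rw [← map_mul, LeftCat.val_gen_mul]) (by rw [← map_mul, LeftCat.val_mul_gen])
  map_id I := LeftCat.hom_ext fun x => (LeftCat.mem_of (map_gen φ I)).1 x.2
  map_comp {I J K} m n := LeftCat.hom_ext fun x => by
    change (x : T) * φ (LeftCat.val (m ≫ n) _) = x * φ (LeftCat.val m _) * φ (LeftCat.val n _)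
    rw [LeftCat.val_comp, LeftCat.val_eq_gen n, map_mul, ← mul_assoc]
    rfl

lemma val_leftMapF (φ : S →ₙ* T) {I J : LeftCat S} (m : I ⟶ J)
    (y : ((leftMapF φ).obj I).carrier) : LeftCat.val ((leftMapF φ).map m) y =
      y * φ (LeftCat.val m ⟨LeftCat.gen I, LeftCat.gen_mem I⟩) := rfl

lemma gen_leftMapF (φ : S →ₙ* T) (I : LeftCat S) :
    LeftCat.gen ((leftMapF φ).obj I) = φ (LeftCat.gen I) := gen_of _ (map_gen φ I)

variable [IsRightRegularBand S]

/-- The order preserving map taking the class of `r^e` to the class of `r^(φ e)`. -/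
noncomputable def leftMapG (φ : S →ₙ* T) : principalClasses S →o principalClasses T where
  toFun d := ⟨rClass (principal (φ d.2.choose)), _, rfl⟩
  monotone' d d' h := by
    have h' : d.1 ≤ d'.1 := h
    rw [d.2.choose_spec, d'.2.choose_spec, toAntisymmetrization_le_toAntisymmetrization_iff,
      principal_le_iff] at h'
    change rClass _ ≤ rClass _
    rw [toAntisymmetrization_le_toAntisymmetrization_iff, principal_le_iff, ← map_mul, h']

lemma leftMapG_eq (φ : S →ₙ* T) (e : S) (h : rClass (principal e) ∈ principalClasses S) :
    (leftMapG φ ⟨rClass (principal e), h⟩).1 = rClass (principal (φ e)) := by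
  have h1 := Quotient.exact h.choose_spec
  have h2 : h.choose * e = e := principal_le_iff.1 h1.1
  have h3 : e * h.choose = h.choose := principal_le_iff.1 h1.2
  refine Quotient.sound ⟨principal_le_iff.2 ?_, principal_le_iff.2 ?_⟩
  · rw [← map_mul, h3]
  · rw [← map_mul, h2]

lemma leftMapF_id : leftMapF (MulHom.id S) = 𝟭 (LeftCat S) := by
  refine CategoryTheory.Functor.ext (fun I => LeftCat.of_gen I) fun I J m => LeftCat.hom_ext fun x => ?_
  rw [LeftCat.val_comp, LeftCat.val_comp, LeftCat.val_eqToHom]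
  change _ = LeftCat.val m _
  rw [LeftCat.val_eq_gen m]
  exact congrArg (· * _) (LeftCat.val_eqToHom _ x).symm

lemma leftMapF_comp {R : Type u} [Semigroup R] [IsRightRegularBand R] (φ : S →ₙ* T)
    (ψ : T →ₙ* R) : leftMapF (ψ.comp φ) = leftMapF φ ⋙ leftMapF ψ := by
  have h : ∀ I, (leftMapF (ψ.comp φ)).obj I = (leftMapF φ ⋙ leftMapF ψ).obj I := fun I =>
    LeftCat.ext (congrArg leftIdeal (congrArg ψ (gen_leftMapF φ I)).symm)
  refine CategoryTheory.Functor.ext h fun I J m => LeftCat.hom_ext fun x => ?_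
  rw [LeftCat.val_comp, LeftCat.val_comp, LeftCat.val_eqToHom]
  change x * ψ (φ _) = LeftCat.val ((leftMapF ψ).map ((leftMapF φ).map m)) _
  have hx : (LeftCat.Hom.toFun (eqToHom (h I)) x : R) = x := LeftCat.val_eqToHom (h I) x
  have hxI : x * ψ (LeftCat.gen ((leftMapF φ).obj I)) = x := by
    rw [gen_leftMapF]
    exact (LeftCat.mem_of (map_gen (ψ.comp φ) I)).1 x.2
  rw [val_leftMapF, val_leftMapF, map_mul, ← mul_assoc, hx]
  exact congrArg (· * _) hxI.symm

lemma leftMapG_id : leftMapG (MulHom.id S) = OrderHom.id := by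
  refine OrderHom.ext _ _ (funext fun d => ?_)
  obtain ⟨_, e, rfl⟩ := d
  exact Subtype.ext (leftMapG_eq (MulHom.id S) e _)

lemma leftMapG_comp {R : Type u} [Semigroup R] [IsRightRegularBand R] (φ : S →ₙ* T)
    (ψ : T →ₙ* R) : leftMapG (ψ.comp φ) = (leftMapG ψ).comp (leftMapG φ) := by
  refine OrderHom.ext _ _ (funext fun d => ?_)
  obtain ⟨_, e, rfl⟩ := d
  refine Subtype.ext ((leftMapG_eq (ψ.comp φ) e _).trans ?_)
  have hm : rClass (principal (φ e)) ∈ principalClasses T := ⟨φ e, rfl⟩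
  have h : leftMapG φ ⟨rClass (principal e), e, rfl⟩ = ⟨rClass (principal (φ e)), hm⟩ :=
    Subtype.ext (leftMapG_eq φ e _)
  change _ = (leftMapG ψ (leftMapG φ _)).1
  rw [h, leftMapG_eq ψ (φ e) hm]
  rfl

/-- The SC-morphism induced by a homomorphism of right regular bands. -/
noncomputable def leftMap (φ : S →ₙ* T) : CC.Hom (leftObj S).obj (leftObj T).obj where
  F := leftMapF φ
  G := leftMapG φ
  map_incl {I J} m hm := fun y => by
    have h : LeftCat.val m ⟨LeftCat.gen I, LeftCat.gen_mem I⟩ = LeftCat.gen I := hm _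
    refine (val_leftMapF φ m y).trans ?_
    rw [h]
    exact (LeftCat.mem_of (map_gen φ I)).1 y.2
  map_connected c d h := by
    obtain ⟨d, hd⟩ := d
    obtain rfl := connectedBy_eq h hd
    exact ⟨LeftCat.principalCone (φ (LeftCat.gen c)) (map_gen φ c), principal_idem _,
      (leftMapG_eq φ _ hd).symm⟩
  map_cone c d ε ε' h h' I := by
    refine LeftCat.hom_ext fun y => ?_
    refine (val_leftMapF φ _ y).trans (Eq.trans ?_ (idemCone_val h' (leftMapG φ d).2 _ y).symm)
    have h1 := idemCone_val h d.2 I ⟨LeftCat.gen I, LeftCat.gen_mem I⟩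
    rw [h1, map_mul, ← mul_assoc, (LeftCat.mem_of (map_gen φ I)).1 y.2]
    exact congrArg _ (gen_leftMapF φ c).symm

end

instance (B : RRB.{u}) : IsRightRegularBand B.obj := B.property

/-- The functor from right regular bands to supported categories, taking a band to the category of
its principal left ideals connected by the `ℛ`-classes of the principal cones. -/
noncomputable def leftFunctor : RRB.{u} ⥤ SC.{u} where
  obj B := leftObj B.obj
  map φ := ObjectProperty.homMk (leftMap φ.hom.hom)
  map_id _ := ObjectProperty.hom_ext _ (CC.Hom.ext leftMapF_id leftMapG_id)
  map_comp φ ψ := ObjectProperty.hom_ext _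
    (CC.Hom.ext (leftMapF_comp φ.hom.hom ψ.hom.hom) (leftMapG_comp φ.hom.hom ψ.hom.hom))

/-- The map `b ↦ r^b` from a right regular band to the band of idempotent cones of its category of
principal left ideals. -/
noncomputable def rhoBar (B : RRB.{u}) : B ⟶ idemFunctor.obj (leftFunctor.obj B) :=
  ObjectProperty.homMk (Semigrp.ofHom
    { toFun := fun b => (⟨⟨principal b, b, rfl⟩, Subtype.ext (principal_idem b)⟩ :
        IdemCones (leftObj B.obj))
      map_mul' := fun a b => Subtype.ext (Subtype.ext (principal_mul a b).symm) })

/-- The category `C` is coreflective in `D`: it is equivalent to a full subcategory of `D` whose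
inclusion functor has a right adjoint. -/
def IsCoreflectiveIn (C D : Type (u + 1)) [Category.{u} C] [Category.{u} D] : Prop :=
  ∃ P : ObjectProperty D, P.ι.IsLeftAdjoint ∧ Nonempty (C ≌ P.FullSubcategory)

end CrossConn

/-! In a supported category an idempotent cone of the connection semigroup is determined by its
vertex, so equalities between such cones are checked on vertices alone.

Uniqueness (`hom_ext_of_unit`): a morphism `(F, G)` out of the category of principal left ideals is
determined by where it sends the cones `r^b`. Objects are the vertices of these cones, the members
of the down-set are their classes, and every morphism splits as `r(e, u, f) = r^u(Se) r^f(Su)`, a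
composite of components of idempotent cones, whose images are prescribed (`map_eq_bridge`).

Existence: the same formula dictates the counit at `X`. It sends the ideal generated by `ε` to the
vertex of `ε`, and the morphism represented by `υ`, where `ευ = υ = υφ`, to `υ(z_ε) φ(z_υ)`, which
is `bridge ε υ φ`. Functoriality is `bridge_comp`, compatibility with cones is `bridge_mul`. One
triangle identity, `rhoBar_counitApp`, is an equality of vertices; naturality of the counit and the
other triangle follow from uniqueness.

The unit is bijective because every idempotent cone over a band is the principal cone at its vertex.
Hence the left adjoint is fully faithful, and its essential image is the required subcategory. Left
regular bands are reduced to right regular ones by reversing the multiplication. -/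

namespace CrossConn

/-! ### Calculus of idempotent cones -/

section

variable {C : Type u} [SmallCategory C] [SubobjectCategory C] [NormalCategory C]

/-- Composing with the image inclusion `j` undoes the passage to the epimorphic component, so
products can be computed without mentioning the chosen factorisation. -/
lemma mul_app_comp_incl (γ δ : Hat C) :
    ∃ j : (γ * δ).vertex ⟶ δ.vertex, IsIncl j ∧
      ∀ c, (γ * δ).cone.app c ≫ j = γ.cone.app c ≫ δ.cone.app γ.vertex := by
  obtain ⟨z, γ⟩ := γ
  obtain ⟨x, δ⟩ := δ
  obtain ⟨v, p, j, hp, hj, h, e⟩ := hat_mul_exists γ δ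
  rw [e]
  refine ⟨j, hj, fun c => ?_⟩
  change (γ.app c ≫ p) ≫ j = γ.app c ≫ δ.app z
  rw [h, Category.assoc]

lemma app_vertex {γ : Hat C} (h : IsIdempotentElem γ) : γ.cone.app γ.vertex = 𝟙 γ.vertex :=
  (idem_app γ.cone).1 h

lemma app_of_incl {γ : Hat C} (h : IsIdempotentElem γ) {a : C} (j : a ⟶ γ.vertex)
    (hj : IsIncl j) : γ.cone.app a = j := by
  rw [← γ.cone.w j hj, app_vertex h, Category.comp_id]

/-- At the vertex of `γ` the formula for the product reads `1 ≫ j = 1 ≫ δ(z_γ)`, so the component of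
`δ` is the inclusion `j` itself. -/
lemma incl_app_of_mul_eq {γ δ : Hat C} (hγ : IsIdempotentElem γ) (h : γ * δ = γ) :
    IsIncl (δ.cone.app γ.vertex) := by
  have key := mul_app_comp_incl γ δ
  -- The rewriting is done while `j` is still bound, since its source depends on `γ * δ`.
  rw [h] at key
  obtain ⟨j, hj, hc⟩ := key
  have := hc γ.vertex
  rw [app_vertex hγ, Category.id_comp, Category.id_comp] at this
  rwa [← this]

/-- The morphism `z_ε ⟶ z_φ` represented by the cone `υ` whenever `ε υ = υ = υ φ`. -/
def bridge (ε υ φ : Hat C) : ε.vertex ⟶ φ.vertex :=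
  υ.cone.app ε.vertex ≫ φ.cone.app υ.vertex

lemma bridge_self {ε : Hat C} (h : IsIdempotentElem ε) : bridge ε ε ε = 𝟙 ε.vertex := by
  rw [bridge, app_vertex h, Category.comp_id]

/-- Two inclusions are absorbed by cones: `j : z_{υν} ⟶ z_ν` by `ψ`, and `φ(z_υ) : z_υ ⟶ z_φ`, an
inclusion because `υφ = υ`, by `ν`. Both sides become `υ(z_ε) φ(z_υ) ν(z_φ) ψ(z_ν)`. -/
lemma bridge_comp {ε υ φ ν ψ : Hat C} (hυ : IsIdempotentElem υ) (h1 : υ * φ = υ) :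
    bridge ε (υ * ν) ψ = bridge ε υ φ ≫ bridge φ ν ψ := by
  obtain ⟨j, hj, hc⟩ := mul_app_comp_incl υ ν
  simp only [bridge, Category.assoc]
  rw [← ψ.cone.w j hj, ← Category.assoc, hc, ← ν.cone.w _ (incl_app_of_mul_eq hυ h1)]
  simp only [Category.assoc]

/-- The component of `r^φ` at the ideal of `ε` is represented by `εφ`; this is what makes the counit
carry components of cones to components of cones. -/
lemma bridge_mul {ε φ : Hat C} (hε : IsIdempotentElem ε) (hφ : IsIdempotentElem φ) :
    bridge ε (ε * φ) φ = φ.cone.app ε.vertex := by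
  obtain ⟨j, hj, hc⟩ := mul_app_comp_incl ε φ
  rw [bridge, app_of_incl hφ j hj, hc, app_vertex hε, Category.id_comp]

end

/-! ### The counit -/

section

variable (X : SC.{u})

/-- The order allows arbitrary cones as right multipliers, but below an idempotent the multiplier
can be `γ` itself, so the order is visible inside the band. -/
lemma IdemCones.le_iff {X : SC.{u}} {γ δ : IdemCones X} : γ.1.1 ≤ δ.1.1 ↔ δ * γ = γ :=
  (idem_le_iff δ.idem).trans
    ⟨fun h => Subtype.ext (Subtype.ext h), fun h => congrArg (fun η => η.1.1) h⟩

lemma IdemCones.coe_mul {X : SC.{u}} (γ δ : IdemCones X) : (γ * δ).1.1 = γ.1.1 * δ.1.1 := rfl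

/-- The functor from the principal left ideals of the band of idempotent cones of `X` to `X`,
taking the ideal generated by a cone to the vertex of that cone. -/
noncomputable def counitF : LeftCat (IdemCones X) ⥤ X.obj.carrier where
  obj I := (LeftCat.gen I).1.1.vertex
  map {I J} m := bridge (LeftCat.gen I).1.1
    (LeftCat.val m ⟨LeftCat.gen I, LeftCat.gen_mem I⟩).1.1 (LeftCat.gen J).1.1
  map_id I := bridge_self (LeftCat.gen I).idem
  map_comp {I J K} m n := by
    -- The composite is represented by the product of the representing cones, because `n` is right
    -- multiplication by its value at the generator. The side condition `υφ = υ` says that the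
    -- values of `m` lie in `J`.
    rw [← bridge_comp (IdemCones.idem _), ← IdemCones.coe_mul, LeftCat.val_comp,
      LeftCat.val_eq_gen n]
    · rfl
    · rw [← IdemCones.coe_mul, LeftCat.val_mul_gen]

/-- The order preserving map taking the class of `r^ε` to the class of `ε`. -/
noncomputable def counitG : principalClasses (IdemCones X) →o X.obj.D where
  toFun d := ⟨rClass d.2.choose.1.1, d.2.choose.1.2⟩
  monotone' d d' h := by
    have h' : d.1 ≤ d'.1 := h
    rw [d.2.choose_spec, d'.2.choose_spec, toAntisymmetrization_le_toAntisymmetrization_iff,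
      principal_le_iff] at h'
    change rClass _ ≤ rClass _
    rwa [toAntisymmetrization_le_toAntisymmetrization_iff, IdemCones.le_iff]

/-- Independence of the chosen representative: `ℛ`-equivalence of `r^e` and `r^f` amounts to `fe =
e` and `ef = f` in the band, and these equations make `e` and `f` equivalent as cones of `X`. -/
lemma counitG_eq (e : IdemCones X)
    (h : rClass (principal e) ∈ principalClasses (IdemCones X)) :
    (counitG X ⟨rClass (principal e), h⟩).1 = rClass e.1.1 := by
  have h1 := Quotient.exact h.choose_spec
  exact Quotient.sound ⟨IdemCones.le_iff.2 (principal_le_iff.1 h1.2),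
    IdemCones.le_iff.2 (principal_le_iff.1 h1.1)⟩

/-- The only class in the down-set connecting `c` is that of `r^ε` with `ε` the generator of `c`,
and `counitG` sends it to the class of `ε`. -/
lemma counit_isIdemCone {c : LeftCat (IdemCones X)} {d : principalClasses (IdemCones X)}
    (h : ConnectedBy c d.1) :
    IsIdemCone (counitG X d).1 (LeftCat.gen c).1.1.cone := by
  obtain ⟨d, hd⟩ := d
  obtain rfl := connectedBy_eq h hd
  exact ⟨(LeftCat.gen c).idem, (counitG_eq X _ hd).symm⟩

/-- The counit of the adjunction at `X`, as a CC-morphism. -/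
noncomputable def counitHom : CC.Hom (leftObj (IdemCones X)).obj X.obj where
  F := counitF X
  G := counitG X
  map_incl {I J} m hm := by
    have h : LeftCat.val m ⟨LeftCat.gen I, LeftCat.gen_mem I⟩ = LeftCat.gen I := hm _
    have h2 := LeftCat.val_mul_gen m ⟨LeftCat.gen I, LeftCat.gen_mem I⟩
    change IsIncl (bridge _ _ _)
    -- An inclusion is represented by the generator of its source, so the first factor of `bridge`
    -- is an identity and the second is an inclusion.
    rw [h] at h2 ⊢
    rw [bridge, app_vertex (IdemCones.idem _), Category.id_comp]
    exact incl_app_of_mul_eq (IdemCones.idem _) (congrArg (fun η => η.1.1) h2)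
  map_connected c d h := ⟨_, counit_isIdemCone X h⟩
  map_cone c d ε ε' h h' I := by
    obtain rfl := h'.unique (counit_isIdemCone X ⟨ε, h⟩)
    -- The component of `ε` at `I` is represented by `gen I * gen c`.
    exact (congrArg (fun η : IdemCones X => bridge (LeftCat.gen I).1.1 η.1.1 (LeftCat.gen c).1.1)
      (idemCone_val h d.2 I ⟨LeftCat.gen I, LeftCat.gen_mem I⟩)).trans
      (bridge_mul (IdemCones.idem _) (IdemCones.idem _))

end

/-! ### Morphisms out of the category of principal left ideals -/

section

variable {B : RRB.{u}} {X : SC.{u}}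

/-- The homomorphism of bands corresponding to an SC-morphism under the adjunction. -/
noncomputable def transpose (m : leftFunctor.obj B ⟶ X) (b : B.obj) : IdemCones X :=
  idemMap m ((rhoBar B).hom.hom b)

/-- The crux of uniqueness: `m` takes components of `r^u` and `r^f` to components of their
transposes, and every morphism is a composite of two such components. The types match because the
vertex of `transpose m e` is by definition the image of `Se`. -/
lemma map_eq_bridge (m : leftFunctor.obj B ⟶ X) {e f u : B.obj} {he : e * e = e}
    {hf : f * f = f} (k : LeftCat.of e he ⟶ LeftCat.of f hf) (h2 : u * f = u)
    (hk : ∀ x, LeftCat.val k x = x * u) :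
    (scHom m).F.map k =
      bridge (transpose m e).1.1 (transpose m u).1.1 (transpose m f).1.1 := by
  have hfac : k = (principal u).cone.app (LeftCat.of e he) ≫
      (principal f).cone.app (principal u).vertex :=
    LeftCat.hom_ext fun x => by
      rw [hk]
      change _ = (x : B.obj) * u * f
      rw [mul_assoc, h2]
  rw [hfac]
  refine ((scHom m).F.map_comp _ _).trans ?_
  exact congr (congrArg _ (idemMap_app m ((rhoBar B).hom.hom u) (LeftCat.of e he)))
    (idemMap_app m ((rhoBar B).hom.hom f) (principal u).vertex)

/-- The transpose records `F` on objects as vertices, `F` on morphisms through `map_eq_bridge`, and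
`G` as `ℛ`-classes. -/
lemma transpose_injective {m n : leftFunctor.obj B ⟶ X} (h : transpose m = transpose n) :
    m = n := by
  have hobj : ∀ I, (scHom m).F.obj I = (scHom n).F.obj I := fun I => by
    obtain ⟨e, he, rfl⟩ := LeftCat.exists_of I
    exact congrArg (fun γ : IdemCones X => γ.1.1.vertex) (congrFun h e)
  refine ObjectProperty.hom_ext _ (CC.Hom.ext (CategoryTheory.Functor.hext hobj fun I J k => ?_)
    (OrderHom.ext _ _ (funext fun d => ?_)))
  · obtain ⟨e, he, rfl⟩ := LeftCat.exists_of I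
    obtain ⟨f, hf, rfl⟩ := LeftCat.exists_of J
    obtain ⟨u, -, h2, hu⟩ := LeftCat.hom_form k
    refine (heq_of_eq (map_eq_bridge m k h2 hu)).trans
      (HEq.trans ?_ (heq_of_eq (map_eq_bridge n k h2 hu).symm))
    -- The two bridges have different types; with the transposes replaced by variables, their
    -- equality can be substituted.
    have key : ∀ a b : B.obj → IdemCones X, a = b →
        HEq (bridge (a e).1.1 (a u).1.1 (a f).1.1) (bridge (b e).1.1 (b u).1.1 (b f).1.1) := by
      rintro a _ rfl
      rfl
    exact key _ _ h
  · obtain ⟨_, e, rfl⟩ := d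
    refine Subtype.ext ?_
    refine (idemMap_isIdemCone m ((rhoBar B).hom.hom e)).2.symm.trans
      (Eq.trans ?_ (idemMap_isIdemCone n ((rhoBar B).hom.hom e)).2)
    exact congrArg (fun γ : IdemCones X => rClass γ.1.1) (congrFun h e)

lemma hom_ext_of_unit {m n : leftFunctor.obj B ⟶ X}
    (h : rhoBar B ≫ idemFunctor.map m = rhoBar B ≫ idemFunctor.map n) : m = n :=
  transpose_injective (funext fun b => congrArg (fun g => g.hom.hom b) h)

variable (X) in
/-- The counit of the adjunction at `X`. -/
noncomputable def counitApp : leftFunctor.obj (idemFunctor.obj X) ⟶ X :=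
  ObjectProperty.homMk (counitHom X)

variable (X) in
-- The composite sends `γ` to a cone whose vertex is that of the generator of the ideal of `γ`; in a
-- right regular band this generator is `γ`.
lemma rhoBar_counitApp :
    rhoBar (idemFunctor.obj X) ≫ idemFunctor.map (counitApp X) = 𝟙 (idemFunctor.obj X) := by
  refine ObjectProperty.hom_ext _ (Semigrp.ext fun γ => ?_)
  refine IdemCones.ext (X := X) ?_
  have h := congrArg (fun δ : IdemCones X => δ.1.1.vertex)
    (gen_of (S := IdemCones X) γ (IsRightRegularBand.idem _))
  exact h

lemma rhoBar_naturality {A B : RRB.{u}} (φ : A ⟶ B) :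
    φ ≫ rhoBar B = rhoBar A ≫ idemFunctor.map (leftFunctor.map φ) := by
  refine ObjectProperty.hom_ext _ (Semigrp.ext fun a => ?_)
  refine IdemCones.ext (X := leftObj B.obj) (LeftCat.ext ?_)
  exact congrArg (fun b => leftIdeal (φ.hom.hom b))
    (gen_of (S := A.obj) a (IsRightRegularBand.idem _)).symm

end

/-! ### The adjunction and its invertible unit -/

/-- The functor of principal left ideals is left adjoint to the functor of idempotent cones. -/
noncomputable def leftIdemAdjunction : leftFunctor.{u} ⊣ idemFunctor.{u} :=
  Adjunction.mkOfUnitCounit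
    { unit := { app := rhoBar, naturality := fun _ _ φ => rhoBar_naturality φ }
      counit :=
        { app := counitApp
          -- After transposition both sides of the square become `idemFunctor.map m`.
          naturality := fun X Y m => hom_ext_of_unit (by
            simp only [Functor.id_obj, Functor.id_map, Functor.comp_map, Functor.map_comp]
            rw [← Category.assoc, ← rhoBar_naturality, Category.assoc, rhoBar_counitApp,
              ← Category.assoc, rhoBar_counitApp]
            exact (Category.comp_id _).trans (Category.id_comp _).symm) }
      left_triangle := by
        ext B : 2
        -- Both sides transpose to `rhoBar B`.
        refine hom_ext_of_unit ?_
        simp only [NatTrans.comp_app, Functor.whiskerRight_app, Functor.associator_hom_app,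
          Functor.whiskerLeft_app, Functor.comp_obj, Functor.id_obj, Category.id_comp,
          Functor.map_comp]
        rw [← Category.assoc, ← rhoBar_naturality, Category.assoc, rhoBar_counitApp]
        exact congrArg _ (idemFunctor.map_id _).symm
      right_triangle := by
        ext X : 2
        simpa using rhoBar_counitApp X }

lemma rhoBar_bijective (B : RRB.{u}) : Function.Bijective (rhoBar B).hom.hom := by
  refine ⟨fun a b h => principal_injective
    (congrArg (fun γ : IdemCones (leftObj B.obj) => γ.1.1) h), fun γ => ?_⟩
  -- The generator `b` of the vertex of `γ` works: `r^b` and `γ` have the same vertex.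
  exact ⟨LeftCat.gen (show IdemCones (leftObj B.obj) from γ).1.1.vertex,
    IdemCones.ext (X := leftObj B.obj) (LeftCat.of_gen _)⟩

lemma rhoBar_isIso (B : RRB.{u}) : IsIso (rhoBar B) := by
  have : IsIso ((ObjectProperty.ι _).map (rhoBar B)) :=
    (MulEquiv.ofBijective (rhoBar B).hom.hom (rhoBar_bijective B)).toSemigrpIso.isIso_hom
  exact isIso_of_reflects_iso _ (ObjectProperty.ι _)

/-- A category with a fully faithful left adjoint functor to `D` is coreflective in `D`. -/
lemma isCoreflectiveIn_of_isLeftAdjoint {C D : Type (u + 1)} [Category.{u} C] [Category.{u} D]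
    (L : C ⥤ D) [L.Full] [L.Faithful] [L.IsLeftAdjoint] : IsCoreflectiveIn C D := by
  refine ⟨L.essImage, ?_, ⟨L.toEssImage.asEquivalence⟩⟩
  -- Up to isomorphism the inclusion of the essential image is an inverse equivalence followed by
  -- `L`, a composite of left adjoints.
  have i : L.toEssImage.inv ⋙ L ≅ L.essImage.ι :=
    (Functor.isoWhiskerLeft L.toEssImage.inv L.toEssImageCompι).symm ≪≫
      (Functor.associator _ _ _).symm ≪≫
      Functor.isoWhiskerRight L.toEssImage.asEquivalence.counitIso _ ≪≫ Functor.leftUnitor _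
  exact Functor.isLeftAdjoint_of_iso i

/-! ### Left regular bands through opposites -/

section

variable (S : Type u) [Semigroup S]

instance [IsLeftRegularBand S] : IsRightRegularBand Sᵐᵒᵖ where
  idem e := MulOpposite.unop_injective (IsLeftRegularBand.idem e.unop)
  reg e f := MulOpposite.unop_injective <| by
    simpa [mul_assoc] using IsLeftRegularBand.reg e.unop f.unop

instance [IsRightRegularBand S] : IsLeftRegularBand Sᵐᵒᵖ where
  idem e := MulOpposite.unop_injective (IsRightRegularBand.idem e.unop)
  reg e f := MulOpposite.unop_injective <| by
    simpa [mul_assoc] using IsRightRegularBand.reg e.unop f.unop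

end

instance (B : LRB.{u}) : IsLeftRegularBand B.obj := B.property

/-- Taking the opposite band is an equivalence of left regular with right regular bands. -/
def lrbEquivRRB : LRB.{u} ≌ RRB.{u} where
  functor :=
    { obj := fun B => ⟨Semigrp.of B.objᵐᵒᵖ, inferInstanceAs (IsRightRegularBand B.objᵐᵒᵖ)⟩
      map := fun φ => ObjectProperty.homMk (Semigrp.ofHom (MulHom.op φ.hom.hom)) }
  inverse :=
    { obj := fun B => ⟨Semigrp.of B.objᵐᵒᵖ, inferInstanceAs (IsLeftRegularBand B.objᵐᵒᵖ)⟩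
      map := fun φ => ObjectProperty.homMk (Semigrp.ofHom (MulHom.op φ.hom.hom)) }
  unitIso := NatIso.ofComponents fun B =>
    ObjectProperty.isoMk _ (MulEquiv.opOp B.obj).toSemigrpIso
  counitIso := NatIso.ofComponents fun B =>
    ObjectProperty.isoMk _ (MulEquiv.opOp B.obj).symm.toSemigrpIso

end CrossConn

theorem mainTheorem7 :
    (∃ adj : CrossConn.leftFunctor.{u} ⊣ CrossConn.idemFunctor.{u},
      ∀ B : CrossConn.RRB.{u}, adj.unit.app B = CrossConn.rhoBar B) ∧
    CrossConn.IsCoreflectiveIn CrossConn.RRB.{u} CrossConn.SC.{u} ∧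
    CrossConn.IsCoreflectiveIn CrossConn.LRB.{u} CrossConn.SC.{u} := by
  have hunit : ∀ B, CrossConn.leftIdemAdjunction.{u}.unit.app B = CrossConn.rhoBar B :=
    fun _ => rfl
  have : IsIso CrossConn.leftIdemAdjunction.{u}.unit := by
    have (B : CrossConn.RRB.{u}) : IsIso (CrossConn.leftIdemAdjunction.{u}.unit.app B) :=
      CrossConn.rhoBar_isIso B
    exact NatIso.isIso_of_isIso_app _
  -- A left adjoint with invertible unit is fully faithful.
  have hff := CrossConn.leftIdemAdjunction.{u}.fullyFaithfulLOfIsIsoUnit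
  have : CrossConn.leftFunctor.{u}.Full := hff.full
  have : CrossConn.leftFunctor.{u}.Faithful := hff.faithful
  have : CrossConn.leftFunctor.{u}.IsLeftAdjoint := CrossConn.leftIdemAdjunction.isLeftAdjoint
  exact ⟨⟨CrossConn.leftIdemAdjunction, hunit⟩,
    CrossConn.isCoreflectiveIn_of_isLeftAdjoint CrossConn.leftFunctor,
    CrossConn.isCoreflectiveIn_of_isLeftAdjoint
      (CrossConn.lrbEquivRRB.functor ⋙ CrossConn.leftFunctor)⟩
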